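/- Let $v\ge 2$, $n\ge 1$, $L\ge 0$ and $0\le\Delta<v$ be integers. For integers $N,M$, an integer $K\ge 1$ and rational numbers $\alpha,\beta$ put $$G(N,M,\alpha,\beta,K,q)=\sum_{j=-\infty}^{\infty}(-1)^j q^{Kj\frac{(\alpha+\beta)j+(\alpha-\beta)}{2}}{N+M \brack N-Kj}_q ,$$ where, for $a,b\in\mathbb Z$, ${a+b \brack a}_q=\frac{(q)_{a+b}}{(q)_a(q)_b}$ if $a,b\ge 0$ and ${a+b\brack a}_q=0$ otherwise, with $(q)_k=\prod_{i=1}^{k}(1-q^i)$ (so the sum over $j$ has only finitely many nonzero terms). Then $$G\!\left(L-\Delta 2^{n-1},\,L+\Delta 2^{n-1},\,(v+\Delta)\Big(2\,\tfrac{2^n-2^{-n}}{3}+\tfrac{1}{2^n v}\Big),\,(v-\Delta)\Big(2\,\tfrac{2^n-2^{-n}}{3}+\tfrac{1}{2^n v}\Big),\,2^n v,\,q\right)$$ is a polynomial in $q$ with non-negative coefficients. -/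

import Mathlib

open Polynomial

/-- The finite product `(q)_n = (q;q)_n = ∏_{j=0}^{n-1} (1 - q^{j+1})`, a polynomial in `q`. -/
noncomputable def qPochhammer (n : ℕ) : ℤ[X] :=
  ∏ j ∈ Finset.range n, (1 - X ^ (j + 1))

/-- The Gaussian polynomial with natural-number entries, by the `q`-Pascal rule
`[n+1, k+1] = [n, k] + q^{k+1} [n, k+1]`. That it is the quotient `(q)_{n+m} / ((q)_n (q)_m)` is
proved in `gaussNat_mul_qPochhammer`. -/
noncomputable def gaussNat : ℕ → ℕ → ℤ[X]
  | _, 0 => 1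
  | 0, _ + 1 => 0
  | n + 1, k + 1 => gaussNat n k + X ^ (k + 1) * gaussNat n (k + 1)

theorem gaussNat_eq_zero_of_lt {n k : ℕ} (h : n < k) : gaussNat n k = 0 := by
  induction n generalizing k with
  | zero =>
    obtain ⟨k, rfl⟩ : ∃ l, k = l + 1 := ⟨k - 1, by omega⟩
    simp [gaussNat]
  | succ n ih =>
    obtain ⟨k, rfl⟩ : ∃ l, k = l + 1 := ⟨k - 1, by omega⟩
    simp [gaussNat, ih (show n < k by omega), ih (show n < k + 1 by omega)]

theorem qPochhammer_succ (n : ℕ) :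
    qPochhammer (n + 1) = qPochhammer n * (1 - X ^ (n + 1)) := by
  simp [qPochhammer, Finset.prod_range_succ]

theorem qPochhammer_ne_zero (n : ℕ) : qPochhammer n ≠ 0 := by
  rw [qPochhammer, Finset.prod_ne_zero_iff]
  intro j _ h
  have := congrArg (Polynomial.eval 0) h
  simp at this

/-- `[n+m, n] · ((q)_n (q)_m) = (q)_{n+m}`; since `(q)_n (q)_m ≠ 0` in the domain `ℤ[q]`,
this determines `gaussNat (n + m) n`. -/
theorem gaussNat_mul_qPochhammer (n m : ℕ) :
    gaussNat (n + m) n * (qPochhammer n * qPochhammer m) = qPochhammer (n + m) := by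
  induction h : n + m generalizing n m with
  | zero =>
    obtain ⟨rfl, rfl⟩ : n = 0 ∧ m = 0 := by omega
    simp [gaussNat, qPochhammer]
  | succ s ih =>
    rcases n with _ | n
    · obtain rfl : m = s + 1 := by omega
      simp [gaussNat, qPochhammer]
    · have h1 := ih n m (by omega)
      rw [gaussNat, qPochhammer_succ s]
      rcases m with _ | m
      · obtain rfl : n = s := by omega
        rw [gaussNat_eq_zero_of_lt (Nat.lt_succ_self n), qPochhammer_succ]
        linear_combination (1 - X ^ (n + 1)) * h1
      · have h2 := ih (n + 1) m (by omega)
        obtain rfl : s = n + m + 1 := by omega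
        rw [qPochhammer_succ m] at h1 ⊢
        rw [qPochhammer_succ n] at h2 ⊢
        linear_combination (1 - X ^ (n + 1)) * h1 + X ^ (n + 1) * (1 - X ^ (m + 1)) * h2

/-- The `q`-binomial coefficient `[A, B]_q` for integers `A`, `B`: with `B = n`, `A = n + m` it is
`(q)_{n+m} / ((q)_n (q)_m)` if `n, m ≥ 0`, and `0` otherwise. -/
noncomputable def qBinomial (A B : ℤ) : ℤ[X] :=
  if 0 ≤ B ∧ 0 ≤ A - B then gaussNat A.toNat B.toNat else 0

theorem qBinomial_natCast (n m : ℕ) :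
    qBinomial ((n : ℤ) + m) n = gaussNat (n + m) n := by
  have h : ((n : ℤ) + m).toNat = n + m := by omega
  simp [qBinomial, h]

/-- Finite sums `∑ c_r q^r` with integer coefficients and rational exponents `r`. -/
abbrev QExp : Type := AddMonoidAlgebra ℤ ℚ

/-- The power `q^r`, for a rational exponent `r`. -/
noncomputable def qPow (r : ℚ) : QExp := AddMonoidAlgebra.single r 1

/-- An ordinary polynomial in `q`, seen as a finite sum with rational exponents. -/
noncomputable def polyToQExp : ℤ[X] →ₐ[ℤ] QExp := Polynomial.aeval (qPow 1)

/-- The term of index `j` of `bressoudG`: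
`(-1)^j q^{K j ((α+β) j + (α-β)) / 2} [N+M, N-Kj]_q`. -/
noncomputable def bressoudTerm (N M : ℤ) (α β : ℚ) (K : ℤ) (j : ℤ) : QExp :=
  (((-1 : ℤˣ) ^ j : ℤˣ) : ℤ) •
    (qPow ((K : ℚ) * j * (((α + β) * j + (α - β)) / 2)) *
      polyToQExp (qBinomial (N + M) (N - K * j)))

/-- `G(N, M, α, β, K, q) = ∑_{j ∈ ℤ} (-1)^j q^{K j ((α+β) j + (α-β)) / 2} [N+M, N-Kj]_q`.
For `K > 0` only finitely many terms are nonzero, see `finite_support_bressoudTerm`. -/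
noncomputable def bressoudG (N M : ℤ) (α β : ℚ) (K : ℤ) : QExp :=
  ∑ᶠ j : ℤ, bressoudTerm N M α β K j

theorem finite_support_bressoudTerm (N M : ℤ) (α β : ℚ) {K : ℤ} (hK : 0 < K) :
    (Function.support (bressoudTerm N M α β K)).Finite := by
  refine (Set.finite_Icc (-(|N| + |M|)) (|N| + |M|)).subset ?_
  intro j hj
  by_contra hj'
  apply hj
  have h : ¬ (0 ≤ N - K * j ∧ 0 ≤ N + M - (N - K * j)) := by
    rintro ⟨h1, h2⟩
    apply hj'
    have hN := le_abs_self N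
    have hM := le_abs_self M
    have hN' := abs_nonneg N
    have hM' := abs_nonneg M
    constructor
    · by_contra hlt
      nlinarith
    · by_contra hlt
      nlinarith
  rw [bressoudTerm, qBinomial, if_neg h]
  simp

/-- `F ≥ 0`: `F` is a polynomial in `q` all of whose coefficients are non-negative. -/
def IsNonnegPoly (F : QExp) : Prop :=
  ∃ P : ℤ[X], (∀ i : ℕ, 0 ≤ P.coeff i) ∧ F = polyToQExp P

/-!
The sums are treated as elements of `QExp`, and positivity means membership in the cone `qCone`
generated by the powers of `q`. After clearing the fractions, the sum of the theorem is
`∑_j (-1)^j q^{e_n(j)} [2L, L - a_j]` with `a_j = 2^(n-1) (Δ + 2 v j)` and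
`e_n(j) = (2 v (4^n - 1) / 3 + 1) j (v j + Δ)`.

*Descent in `n`.* The doubling transform `finsum_doubling` reads
`∑_k c_{L,k}(q) [k, (k - a) / 2] = q^{a²/2} [2L, L - a]`, with `k ≡ a` modulo `2` and coefficients
`c_{L,k}` in the cone; it is two applications of the `q`-Vandermonde sum. Since
`e_{n+1}(j) - e_n(j) = (a_j² - a_0²) / 2` for `a_j = 2^n (Δ + 2 v j)`, it exhibits the sum at level
`n + 1` as a positive combination of sums at level `n` (`finsum_level_succ`). This leaves
`n = 0`, that is, `∑_j (-1)^j q^{j (v j + Δ)} [k, (k - Δ) / 2 - v j]`.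

*The case `n = 0`.* Consider the sums of
`(-1)^j q^e [L + M + a - b, L + a] [L + M - a + b, L - a]` over `j`, where `a = a_j` and `b = b_j`
are affine in `j` (`altSum`). The Burge transform (`altSum_burge`, a consequence of the
`q`-Pfaff–Saalschütz sum `gauss_saalschutz`) expresses the sum with `a + b` in place of `a`
positively through those with `a`. Its limit `M → ∞` (`finsum_burge_limit`) produces the sums at
`n = 0`: there `a_j = v j + Δ / 2` is reached by `v - Δ` contributions `b_j = j` followed by `Δ`
contributions `b_j = j + 1/2`. Three facts about the beginning of this chain suffice.
The sum with `a_j = b_j = j` is positive, by comparing coefficients in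
`∏ (1 + q^i Y) (1 - q^i Y) = ∏ (1 - q^{2i} Y²)` (`altSum_one_zero_zero_mem_qCone`). The sum with
`a_j = 0`, `b_j = j + 1/2` vanishes by antisymmetry (`altSum_zero_zero_one`). Finally
`b_j = j` can be replaced by `b_j = j + 1/2` at the cost of a further sum that is the Burge
transform of a sum with smaller slope (`altSum_pascal`), so an induction on the slope applies.

Sums over `j` are `finsum`s. Since `QExp` has no zero divisors and is torsion-free as an abelian
group, factors can be moved through a `finsum` without a finiteness hypothesis.
-/

/-! ### Powers of `q` and the cone of non-negative sums -/

theorem qPow_add (r s : ℚ) : qPow (r + s) = qPow r * qPow s := by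
  simp [qPow, AddMonoidAlgebra.single_mul_single]

theorem qPow_zero : qPow 0 = 1 := rfl

theorem qPow_one_pow (n : ℕ) : qPow 1 ^ n = qPow n := by
  simp [qPow, AddMonoidAlgebra.single_pow]

theorem polyToQExp_X_pow (n : ℕ) : polyToQExp (X ^ n) = qPow n := by
  simp [polyToQExp, qPow_one_pow]

/-- The sums `∑ c_r q^r` with all `c_r ≥ 0`, presented as the subsemiring generated by the powers
of `q`, so that its closure properties are automatic. -/
noncomputable def qCone : Subsemiring QExp := Subsemiring.closure (Set.range qPow)

theorem qPow_mem_qCone (r : ℚ) : qPow r ∈ qCone :=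
  Subsemiring.subset_closure ⟨r, rfl⟩

theorem coeff_nonneg_of_mem_qCone {F : QExp} (hF : F ∈ qCone) (r : ℚ) : 0 ≤ F.coeff r := by
  classical
  induction hF using Subsemiring.closure_induction generalizing r with
  | mem x hx =>
    obtain ⟨s, rfl⟩ := hx
    simp only [qPow, AddMonoidAlgebra.coeff_single, Finsupp.single_apply]
    split_ifs <;> simp
  | zero => simp
  | one =>
    rw [← qPow_zero]
    simp only [qPow, AddMonoidAlgebra.coeff_single, Finsupp.single_apply]
    split_ifs <;> simp
  | add x y _ _ hx hy => simpa using add_nonneg (hx r) (hy r)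
  | mul x y _ _ hx hy =>
    rw [AddMonoidAlgebra.coeff_mul]
    refine Finset.sum_nonneg fun a _ => Finset.sum_nonneg fun b _ => ?_
    dsimp only
    split_ifs
    · exact mul_nonneg (hx a) (hy b)
    · exact le_rfl

theorem coeff_polyToQExp (P : ℤ[X]) (i : ℕ) : (polyToQExp P).coeff (i : ℚ) = P.coeff i := by
  classical
  induction P using Polynomial.induction_on' with
  | add p q hp hq => simp [hp, hq]
  | monomial n a =>
    have : polyToQExp (monomial n a) = a • qPow n := by
      rw [← C_mul_X_pow_eq_monomial, map_mul, polyToQExp_X_pow]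
      simp
    rw [this, AddMonoidAlgebra.coeff_smul_apply, coeff_monomial]
    simp [qPow, Finsupp.single_apply]

theorem isNonnegPoly_of_mem {F : QExp} (hF : F ∈ qCone) (hP : F ∈ polyToQExp.range) :
    IsNonnegPoly F := by
  obtain ⟨P, rfl⟩ := hP
  refine ⟨P, fun i => ?_, rfl⟩
  rw [← coeff_polyToQExp]
  exact coeff_nonneg_of_mem_qCone hF _

/-! ### Gaussian polynomials with integer entries -/

/-- The Gaussian polynomial `[x + y, x]_q`, written symmetrically in the lower entry `x` and the
co-entry `y`; it vanishes unless `x, y ≥ 0`. -/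
noncomputable def gauss (x y : ℤ) : QExp := polyToQExp (qBinomial (x + y) x)

theorem gauss_natCast (n m : ℕ) : gauss n m = polyToQExp (gaussNat (n + m) n) := by
  rw [gauss, qBinomial_natCast]

theorem gauss_eq_zero {x y : ℤ} (h : x < 0 ∨ y < 0) : gauss x y = 0 := by
  rw [gauss, qBinomial, if_neg (by omega), map_zero]

theorem gauss_ne_zero {x y : ℤ} (h : gauss x y ≠ 0) : 0 ≤ x ∧ 0 ≤ y := by
  by_contra h'
  exact h (gauss_eq_zero (by omega))

theorem gauss_zero_left {y : ℤ} (hy : 0 ≤ y) : gauss 0 y = 1 := by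
  lift y to ℕ using hy
  have := gauss_natCast 0 y
  simpa [gaussNat] using this

theorem gauss_comm (x y : ℤ) : gauss x y = gauss y x := by
  by_cases h : 0 ≤ x ∧ 0 ≤ y
  · obtain ⟨hx, hy⟩ := h
    lift x to ℕ using hx
    lift y to ℕ using hy
    rw [gauss_natCast, gauss_natCast]
    congr 1
    have h1 := gaussNat_mul_qPochhammer x y
    have h2 := gaussNat_mul_qPochhammer y x
    refine mul_right_cancel₀ (mul_ne_zero (qPochhammer_ne_zero x) (qPochhammer_ne_zero y)) ?_
    rw [h1, mul_comm (qPochhammer x), h2, add_comm]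
  · rw [gauss_eq_zero (by omega), gauss_eq_zero (by omega)]

theorem gauss_zero_right {x : ℤ} (hx : 0 ≤ x) : gauss x 0 = 1 := by
  rw [gauss_comm, gauss_zero_left hx]

/-- Both sides are the `q`-multinomial coefficient with entries `x, y, z`. -/
theorem gauss_mul_gauss (x y z : ℤ) :
    gauss x (y + z) * gauss y z = gauss (x + y) z * gauss x y := by
  by_cases h : 0 ≤ x ∧ 0 ≤ y ∧ 0 ≤ z
  · obtain ⟨hx, hy, hz⟩ := h
    lift x to ℕ using hx
    lift y to ℕ using hy
    lift z to ℕ using hz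
    have e1 := gauss_natCast x (y + z)
    have e2 := gauss_natCast (x + y) z
    push_cast at e1 e2
    rw [e1, e2, gauss_natCast, gauss_natCast, ← map_mul, ← map_mul]
    congr 1
    have h1 := gaussNat_mul_qPochhammer x (y + z)
    have h2 := gaussNat_mul_qPochhammer y z
    have h3 := gaussNat_mul_qPochhammer (x + y) z
    have h4 := gaussNat_mul_qPochhammer x y
    rw [← add_assoc] at h1
    refine mul_right_cancel₀ (mul_ne_zero (mul_ne_zero (qPochhammer_ne_zero x)
      (qPochhammer_ne_zero y)) (qPochhammer_ne_zero z)) ?_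
    rw [← add_assoc]
    linear_combination gaussNat (x + y + z) x * qPochhammer x * h2 + h1 - h3 -
      gaussNat (x + y + z) (x + y) * qPochhammer z * h4
  · by_cases hx : 0 ≤ x
    · by_cases hy : 0 ≤ y
      · rw [gauss_eq_zero (show y < 0 ∨ z < 0 by omega),
          gauss_eq_zero (show x + y < 0 ∨ z < 0 by omega)]
        simp
      · rw [gauss_eq_zero (show y < 0 ∨ z < 0 by omega),
          gauss_eq_zero (show x < 0 ∨ y < 0 by omega)]
        simp
    · rw [gauss_eq_zero (show x < 0 ∨ y + z < 0 by omega),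
          gauss_eq_zero (show x < 0 ∨ y < 0 by omega)]
      simp

/-- The `q`-Pascal rule. The hypothesis excludes only the corner `gauss 0 0 = 1`. -/
theorem gauss_pascal {x y : ℤ} (h : 0 ≤ x + y) :
    gauss (x + 1) y = gauss x y + qPow (x + 1) * gauss (x + 1) (y - 1) := by
  rcases lt_trichotomy x (-1) with hx | rfl | hx
  · rw [gauss_eq_zero (by omega), gauss_eq_zero (by omega), gauss_eq_zero (by omega)]
    simp
  · rw [gauss_eq_zero (show (-1 : ℤ) < 0 ∨ y < 0 by omega)]
    norm_num
    rw [gauss_zero_left (by omega), gauss_zero_left (by omega), qPow_zero, one_mul]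
  · rcases lt_trichotomy y 0 with hy | rfl | hy
    · rw [gauss_eq_zero (by omega), gauss_eq_zero (by omega), gauss_eq_zero (by omega)]
      simp
    · rw [gauss_zero_right (by omega), gauss_zero_right (by omega), gauss_eq_zero (by omega)]
      simp
    · obtain ⟨m, rfl⟩ : ∃ m : ℕ, y = m + 1 := ⟨(y - 1).toNat, by omega⟩
      obtain ⟨n, rfl⟩ : ∃ n : ℕ, x = n := ⟨x.toNat, by omega⟩
      have e1 := gauss_natCast (n + 1) (m + 1)
      have e2 := gauss_natCast n (m + 1)
      have e3 := gauss_natCast (n + 1) m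
      push_cast at e1 e2 e3
      rw [add_sub_cancel_right, e1, e2, e3, show n + 1 + (m + 1) = (n + (m + 1)) + 1 by omega,
        gaussNat, map_add, map_mul, polyToQExp_X_pow, show n + 1 + m = n + (m + 1) by omega]
      push_cast
      rfl

theorem gauss_pascal' {x y : ℤ} (h : 0 ≤ x + y) :
    gauss x (y + 1) = gauss x y + qPow (y + 1) * gauss (x - 1) (y + 1) := by
  rw [gauss_comm, gauss_pascal (by omega), gauss_comm y, gauss_comm (y + 1)]

theorem gauss_mem_qCone (x y : ℤ) : gauss x y ∈ qCone := by
  have key (n k : ℕ) : polyToQExp (gaussNat n k) ∈ qCone := by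
    induction n generalizing k with
    | zero => cases k <;> simp [gaussNat, zero_mem, one_mem]
    | succ n ih =>
      cases k with
      | zero => simp [gaussNat, one_mem]
      | succ k =>
        rw [gaussNat, map_add, map_mul, polyToQExp_X_pow]
        exact add_mem (ih _) (mul_mem (qPow_mem_qCone _) (ih _))
  by_cases h : 0 ≤ x ∧ 0 ≤ y
  · obtain ⟨hx, hy⟩ := h
    lift x to ℕ using hx
    lift y to ℕ using hy
    rw [gauss_natCast]
    exact key _ _
  · rw [gauss_eq_zero (by omega)]
    exact zero_mem _

/-! ### The `q`-Vandermonde and `q`-Pfaff–Saalschütz sums -/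

theorem support_finite_of_bound {R : Type*} [Zero R] {f : ℤ → R} (A B : ℤ)
    (h : ∀ t, f t ≠ 0 → A ≤ t ∧ t ≤ B) : f.HasFiniteSupport :=
  (Set.finite_Icc A B).subset fun t ht => h t ht

theorem gauss_vandermonde {X : ℤ} (hX : 0 ≤ X) {Y : ℤ} (hY : 0 ≤ Y) (c : ℤ) :
    ∑ᶠ t : ℤ, qPow (t * (t + c)) * gauss t (X - t) * gauss (t + c) (Y - t - c) =
      gauss (X + c) (Y - c) := by
  lift X to ℕ using hX
  induction X generalizing c with
  | zero =>
    rw [finsum_eq_single _ 0]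
    · simp [gauss_zero_left, qPow_zero]
    · intro t ht
      rw [gauss_eq_zero (x := t) (by push_cast; omega)]
      simp
  | succ X ih =>
    have split (t : ℤ) : qPow (t * (t + c)) * gauss t ((X + 1 : ℕ) - t) *
        gauss (t + c) (Y - t - c) =
        qPow (t * (t + c)) * gauss t (X - t) * gauss (t + c) (Y - t - c) +
        qPow (X + c + 1) * (qPow ((t - 1) * ((t - 1) + (c + 1))) * gauss (t - 1) (X - (t - 1)) *
          gauss ((t - 1) + (c + 1)) (Y - (t - 1) - (c + 1))) := by
      have h := gauss_pascal' (x := t) (y := X - t) (by omega)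
      rw [show ((X + 1 : ℕ) : ℤ) - t = X - t + 1 by push_cast; ring, h,
        show (X : ℤ) - (t - 1) = X - t + 1 by ring, show t - 1 + (c + 1) = t + c by ring,
        show Y - (t - 1) - (c + 1) = Y - t - c by ring]
      have e : qPow (t * (t + c)) * qPow (((X - t : ℤ) : ℚ) + 1) =
          qPow (X + c + 1) * qPow ((t - 1) * ((t - 1) + (c + 1))) := by
        rw [← qPow_add, ← qPow_add]
        congr 1
        push_cast
        ring
      linear_combination gauss (t - 1) (X - t + 1) * gauss (t + c) (Y - t - c) * e
    have fin (c : ℤ) : (fun t : ℤ => qPow (t * (t + c)) * gauss t (X - t) *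
        gauss (t + c) (Y - t - c)).HasFiniteSupport := by
      refine support_finite_of_bound 0 X fun t ht => ?_
      have := gauss_ne_zero (right_ne_zero_of_mul (left_ne_zero_of_mul ht))
      omega
    have fin' : (fun t : ℤ => qPow (X + c + 1) * (qPow ((t - 1) * ((t - 1) + (c + 1))) *
        gauss (t - 1) (X - (t - 1)) *
          gauss ((t - 1) + (c + 1)) (Y - (t - 1) - (c + 1)))).HasFiniteSupport := by
      refine support_finite_of_bound 0 (X + 1) fun t ht => ?_
      have := gauss_ne_zero
        (right_ne_zero_of_mul (left_ne_zero_of_mul (right_ne_zero_of_mul ht)))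
      omega
    have shift := finsum_comp_equiv (Equiv.subRight (1 : ℤ)) (f := fun t : ℤ =>
      qPow (t * (t + ((c + 1 : ℤ) : ℚ))) * gauss t (X - t) *
        gauss (t + (c + 1)) (Y - t - (c + 1)))
    simp only [Equiv.subRight_apply, Int.cast_sub, Int.cast_one, Int.cast_add] at shift
    rw [finsum_congr split, finsum_add_distrib (fin c) fin', ih c, ← mul_finsum, shift]
    have ih' := ih (c + 1)
    push_cast at ih'
    have p := gauss_pascal (x := X + c) (y := Y - c) (by omega)
    push_cast at p ⊢
    rw [ih', show (X : ℤ) + 1 + c = X + c + 1 by ring, p,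
      show (X : ℤ) + (c + 1) = X + c + 1 by ring, sub_add_eq_sub_sub]

theorem finsum_swap {R : Type*} [AddCommMonoid R] {F : ℤ → ℤ → R} (A B A' B' : ℤ)
    (h : ∀ t r, F t r ≠ 0 → (A ≤ t ∧ t ≤ B) ∧ (A' ≤ r ∧ r ≤ B')) :
    ∑ᶠ t, ∑ᶠ r, F t r = ∑ᶠ r, ∑ᶠ t, F t r := by
  have h1 (t : ℤ) : ∑ᶠ r, F t r = ∑ r ∈ Finset.Icc A' B', F t r :=
    finsum_eq_sum_of_support_subset _ fun r hr => by simpa using (h t r hr).2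
  have h2 : ∑ᶠ r, ∑ᶠ t, F t r = ∑ r ∈ Finset.Icc A' B', ∑ᶠ t, F t r := by
    refine finsum_eq_sum_of_support_subset _ fun r hr => ?_
    obtain ⟨t, ht⟩ : ∃ t, F t r ≠ 0 := by
      by_contra! h0
      exact hr (finsum_eq_zero_of_forall_eq_zero h0)
    simpa using (h t r ht).2
  rw [finsum_congr h1, h2, finsum_sum_comm]
  intro r _
  exact support_finite_of_bound A B fun t ht => (h t r ht).1

/-- A form of the `q`-Pfaff–Saalschütz summation. The last factor on the left is expanded by
`gauss_vandermonde`; after exchanging the summations both remaining sums are again of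
`q`-Vandermonde type. -/
theorem gauss_saalschutz {X Y : ℤ} (hX : 0 ≤ X) (hY : 0 ≤ Y) (c N : ℤ) :
    ∑ᶠ t : ℤ, qPow (t * (t + c)) * gauss t (X - t) * gauss (t + c) (Y - t - c) *
      gauss (X + Y) (N - t) = gauss (X + c) N * gauss (N + c) (Y - c) := by
  by_cases hpos : 0 ≤ X + c ∧ 0 ≤ N
  swap
  · rw [gauss_eq_zero (show X + c < 0 ∨ N < 0 by omega), zero_mul]
    refine finsum_eq_zero_of_forall_eq_zero fun t => ?_
    by_contra ht
    have h1 := gauss_ne_zero (right_ne_zero_of_mul ht)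
    have h2 := gauss_ne_zero (right_ne_zero_of_mul (left_ne_zero_of_mul ht))
    have h3 := gauss_ne_zero
      (right_ne_zero_of_mul (left_ne_zero_of_mul (left_ne_zero_of_mul ht)))
    omega
  obtain ⟨hXc, hN⟩ := hpos
  have expand (t : ℤ) : qPow (t * (t + c)) * gauss t (X - t) * gauss (t + c) (Y - t - c) *
      gauss (X + Y) (N - t) = ∑ᶠ r : ℤ, qPow (r * (r + c)) * qPow ((r - t) * (X - t)) *
        gauss t (X - t) * gauss (t + c) (r - t) * gauss (r + c) (Y - r - c) *
        gauss (X + c + r) (N - r) := by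
    by_cases hY' : 0 ≤ Y - c - t
    · have v := gauss_vandermonde hY' (show 0 ≤ X + c + N by omega) (X + c + t)
      rw [← finsum_comp_equiv (Equiv.subRight t)] at v
      simp only [Equiv.subRight_apply] at v
      rw [show Y - c - t + (X + c + t) = X + Y by ring,
        show X + c + N - (X + c + t) = N - t by ring] at v
      rw [← v, mul_finsum]
      refine finsum_congr fun r => ?_
      have m := gauss_mul_gauss (t + c) (r - t) (Y - r - c)
      rw [show r - t + (Y - r - c) = Y - t - c by ring, show t + c + (r - t) = r + c by ring] at m
      have e : qPow (t * (t + c)) * qPow (((r - t : ℤ) : ℚ) * ((r - t : ℤ) + (X + c + t : ℤ))) =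
          qPow (r * (r + c)) * qPow ((r - t) * (X - t)) := by
        rw [← qPow_add, ← qPow_add]
        congr 1
        push_cast
        ring
      rw [show Y - c - t - (r - t) = Y - r - c by ring, show r - t + (X + c + t) = X + c + r by ring,
        show X + c + N - (r - t) - (X + c + t) = N - r by ring]
      linear_combination gauss t (X - t) * gauss (X + c + r) (N - r) *
        (e * (gauss (t + c) (Y - t - c) * gauss (r - t) (Y - r - c)) +
          qPow (r * (r + c)) * qPow ((r - t) * (X - t)) * m)
    · rw [gauss_eq_zero (show t + c < 0 ∨ Y - t - c < 0 by omega), mul_zero, zero_mul]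
      refine (finsum_eq_zero_of_forall_eq_zero fun r => ?_).symm
      by_cases hr : 0 ≤ r - t
      · rw [gauss_eq_zero (show r + c < 0 ∨ Y - r - c < 0 by omega)]
        simp
      · rw [gauss_eq_zero (show t + c < 0 ∨ r - t < 0 by omega)]
        simp
  have inner (r : ℤ) : ∑ᶠ t : ℤ, qPow (r * (r + c)) * qPow ((r - t) * (X - t)) *
        gauss t (X - t) * gauss (t + c) (r - t) * gauss (r + c) (Y - r - c) *
        gauss (X + c + r) (N - r) =
      gauss (X + c) N * (qPow (r * (r + c)) * gauss r (N - r) * gauss (r + c) (Y - r - c)) := by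
    by_cases hr : 0 ≤ r + c
    · have v := gauss_vandermonde hX hr (r - X)
      rw [← finsum_comp_equiv (Equiv.subLeft X)] at v
      simp only [Equiv.subLeft_apply] at v
      rw [show X + (r - X) = r by ring, show r + c - (r - X) = X + c by ring] at v
      have m := gauss_mul_gauss (X + c) r (N - r)
      rw [show r + (N - r) = N by ring, gauss_comm (X + c) r, ← v] at m
      calc _ = (qPow (r * (r + c)) * gauss (r + c) (Y - r - c)) *
            (gauss (X + c + r) (N - r) * ∑ᶠ t : ℤ, qPow (((X - t : ℤ) : ℚ) * ((X - t : ℤ) +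
              (r - X : ℤ))) * gauss (X - t) (X - (X - t)) *
              gauss (X - t + (r - X)) (r + c - (X - t) - (r - X))) := by
            rw [mul_finsum, mul_finsum]
            refine finsum_congr fun t => ?_
            rw [show X - (X - t) = t by ring, show X - t + (r - X) = r - t by ring,
              show r + c - (X - t) - (r - X) = t + c by ring, gauss_comm (X - t), gauss_comm (r - t),
              show (((X - t : ℤ) : ℚ) * ((X - t : ℤ) + (r - X : ℤ))) = (r - t) * (X - t) by
                push_cast; ring]
            ring
        _ = _ := by rw [← m]; ring
    · rw [gauss_eq_zero (show r + c < 0 ∨ Y - r - c < 0 by omega)]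
      simp
  rw [finsum_congr expand, finsum_swap 0 X 0 N, finsum_congr inner, ← mul_finsum,
    gauss_vandermonde hN hY]
  intro t r ht
  have h1 := gauss_ne_zero (right_ne_zero_of_mul ht)
  have h2 := left_ne_zero_of_mul (left_ne_zero_of_mul ht)
  have h3 := gauss_ne_zero (right_ne_zero_of_mul h2)
  have h4 := gauss_ne_zero (right_ne_zero_of_mul (left_ne_zero_of_mul h2))
  omega

/-! ### Alternating sums and the Burge transform -/

/-- The sign `(-1)^j`, for an integer `j`. -/
noncomputable def altSign (j : ℤ) : ℤ := (((-1 : ℤˣ) ^ j : ℤˣ) : ℤ)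

/-- The alternating sum
`∑_j (-1)^j q^{μ j² + d j} [l + M + (μ-1) j + d, M - j] [l + M - (μ-1) j + ε, M + j + ε]`.
With `a_j = μ j + d / 2`, `b_j = j + ε / 2`, `L = l + d / 2` and `M' = M + ε / 2` the lower entries
are `L ± a_j` and `M' ± b_j`; the integer parameters avoid the half-integers. -/
noncomputable def altSum (μ d ε l M : ℤ) : QExp :=
  ∑ᶠ j : ℤ, altSign j • (qPow (μ * j ^ 2 + d * j) * gauss (l + μ * j + d) (M - j) *
    gauss (l - μ * j) (M + j + ε))

/-- The common part of the Burge transform and its limit: exchanging the summations over `I` and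
`j` leaves, for each `j`, a sum over `t = I - j` of hypergeometric type. The weight `w` decides
which summation formula evaluates it. -/
theorem altSum_convolution (w : ℤ → QExp) (μ d l : ℤ) {ε : ℤ} (hε : ε = 0 ∨ ε = 1) :
    ∑ᶠ I : ℤ, qPow (I * (I + ε)) * w I * altSum μ d ε (l - I) I =
      ∑ᶠ j : ℤ, altSign j • (qPow ((μ + 1) * j ^ 2 + (d + ε) * j) *
        ∑ᶠ t : ℤ, qPow (t * (t + (2 * j + ε : ℤ))) * gauss t (l - j + μ * j + d - t) *
          gauss (t + (2 * j + ε)) (l - μ * j + j + ε - t - (2 * j + ε)) * w (t + j)) := by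
  have h1 (I : ℤ) : qPow (I * (I + ε)) * w I * altSum μ d ε (l - I) I =
      ∑ᶠ j : ℤ, altSign j • (qPow (I * (I + ε)) * w I * (qPow (μ * j ^ 2 + d * j) *
        gauss (l - I + μ * j + d) (I - j) * gauss (l - I - μ * j) (I + j + ε))) := by
    rw [altSum, mul_finsum]
    exact finsum_congr fun j => mul_smul_comm _ _ _
  rw [finsum_congr h1, finsum_swap 0 (2 * l + d) (-(2 * l + d) - 1) (2 * l + d)]
  · refine finsum_congr fun j => ?_
    rw [← smul_finsum]
    congr 1
    rw [← finsum_comp_equiv (Equiv.addRight j), mul_finsum]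
    refine finsum_congr fun t => ?_
    rw [Equiv.coe_addRight, gauss_comm t, gauss_comm (t + (2 * j + ε)),
      show l - (t + j) + μ * j + d = l - j + μ * j + d - t by ring,
      show l - (t + j) - μ * j = l - μ * j + j + ε - t - (2 * j + ε) by ring,
      show t + j - j = t by ring, show t + j + j + ε = t + (2 * j + ε) by ring]
    have e : qPow (((t + j : ℤ) : ℚ) * ((t + j : ℤ) + ε)) * qPow (μ * j ^ 2 + d * j) =
        qPow ((μ + 1) * j ^ 2 + (d + ε) * j) * qPow (t * (t + (2 * j + ε : ℤ))) := by
      rw [← qPow_add, ← qPow_add]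
      congr 1
      push_cast
      ring
    linear_combination w (t + j) * gauss (l - j + μ * j + d - t) t *
      gauss (l - μ * j + j + ε - t - (2 * j + ε)) (t + (2 * j + ε)) * e
  · intro I j h
    have h := right_ne_zero_of_mul (right_ne_zero_of_smul h)
    have h2 := gauss_ne_zero (right_ne_zero_of_mul h)
    have h3 := gauss_ne_zero (right_ne_zero_of_mul (left_ne_zero_of_mul h))
    omega

/-- For `0 ≤ d ≤ 2 μ` the numbers `a_j` and `b_j` have the same sign, so the upper entries
`L ± (a_j - b_j)` are non-negative as soon as `L ± (a_j + b_j)` are. -/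
theorem entries_nonneg {μ d l ε j : ℤ} (hε : ε = 0 ∨ ε = 1) (hd : 0 ≤ d) (hμ : d ≤ 2 * μ)
    (h1 : 0 ≤ l - j + μ * j + d + (2 * j + ε)) (h2 : 0 ≤ l - μ * j + j + ε - (2 * j + ε)) :
    0 ≤ l - j + μ * j + d ∧ 0 ≤ l - μ * j + j + ε := by
  rcases lt_or_ge j 0 with hj | hj
  · have : 0 ≤ (2 * μ - d) * (-j) := mul_nonneg (by omega) (by omega)
    have : 0 ≤ d * (-j - 1) := mul_nonneg hd (by omega)
    constructor
    · omega
    · nlinarith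
  · have : 0 ≤ μ * j := mul_nonneg (by omega) hj
    constructor <;> omega

/-- The Burge transform: it raises `a_j` by `b_j`. -/
theorem altSum_burge (l M : ℤ) {μ d ε : ℤ} (hε : ε = 0 ∨ ε = 1) (hd : 0 ≤ d) (hμ : d ≤ 2 * μ) :
    altSum (μ + 1) (d + ε) ε l M =
      ∑ᶠ I : ℤ, qPow (I * (I + ε)) * gauss (2 * l + d + ε) (M - I) *
        altSum μ d ε (l - I) I := by
  rw [altSum_convolution (fun I => gauss (2 * l + d + ε) (M - I)) μ d l hε, altSum]
  refine finsum_congr fun j => ?_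
  congr 1
  push_cast
  rw [mul_assoc]
  congr 1
  by_cases h : 0 ≤ l - j + μ * j + d ∧ 0 ≤ l - μ * j + j + ε
  · have s := gauss_saalschutz h.1 h.2 (2 * j + ε) (M - j)
    rw [show l - j + μ * j + d + (l - μ * j + j + ε) = 2 * l + d + ε by ring] at s
    push_cast at s
    simp only [sub_sub M, add_comm j] at s
    rw [s, gauss_comm (M - j + _)]
    congr 2 <;> ring
  · trans 0
    · by_contra h0
      have g1 := gauss_ne_zero (left_ne_zero_of_mul h0)
      have g2 := gauss_ne_zero (right_ne_zero_of_mul h0)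
      rw [add_mul] at g1 g2
      exact h (entries_nonneg hε hd hμ (by omega) (by omega))
    · refine (finsum_eq_zero_of_forall_eq_zero fun t => ?_).symm
      by_contra h0
      have g := left_ne_zero_of_mul h0
      have g1 := gauss_ne_zero (right_ne_zero_of_mul g)
      have g2 := gauss_ne_zero (right_ne_zero_of_mul (left_ne_zero_of_mul g))
      omega

/-- The limit `M → ∞` of `altSum_burge`, in which only one Gaussian polynomial survives. -/
theorem finsum_burge_limit (l : ℤ) {μ d ε : ℤ} (hε : ε = 0 ∨ ε = 1) (hd : 0 ≤ d)
    (hμ : d ≤ 2 * μ) :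
    ∑ᶠ j : ℤ, altSign j • (qPow ((μ + 1) * j ^ 2 + (d + ε) * j) *
        gauss (l - (μ + 1) * j) (l + (μ + 1) * j + (d + ε))) =
      ∑ᶠ I : ℤ, qPow (I * (I + ε)) * altSum μ d ε (l - I) I := by
  have c := altSum_convolution (fun _ => 1) μ d l hε
  simp only [mul_one] at c
  rw [c]
  refine finsum_congr fun j => ?_
  congr 2
  by_cases h : 0 ≤ l - j + μ * j + d ∧ 0 ≤ l - μ * j + j + ε
  · rw [gauss_vandermonde h.1 h.2 (2 * j + ε), gauss_comm]
    congr 1 <;> ring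
  · trans 0
    · by_contra h0
      have g1 := gauss_ne_zero h0
      rw [add_mul] at g1
      exact h (entries_nonneg hε hd hμ (by omega) (by omega))
    · refine (finsum_eq_zero_of_forall_eq_zero fun t => ?_).symm
      by_contra h0
      have g1 := gauss_ne_zero (right_ne_zero_of_mul h0)
      have g2 := gauss_ne_zero (right_ne_zero_of_mul (left_ne_zero_of_mul h0))
      omega

/-! ### Positivity of the alternating sums -/

theorem altSign_add (i j : ℤ) : altSign (i + j) = altSign i * altSign j := by
  simp [altSign, zpow_add]

theorem altSign_sub (i j : ℤ) : altSign (i - j) = altSign i * altSign j := by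
  rcases Int.even_or_odd j with hj | hj <;> simp [altSign, zpow_sub, hj.neg_one_zpow]

theorem altSign_natCast (n : ℕ) : altSign n = (-1) ^ n := by
  simp [altSign]

theorem altSign_mul_self (j : ℤ) : altSign j * altSign j = 1 := by
  simp [altSign, ← Units.val_mul]

theorem altSum_hasFiniteSupport (μ d l M ε : ℤ) :
    (fun j : ℤ => altSign j • (qPow (μ * j ^ 2 + d * j) * gauss (l + μ * j + d) (M - j) *
      gauss (l - μ * j) (M + j + ε))).HasFiniteSupport := by
  refine support_finite_of_bound (-M - ε) M fun j h => ?_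
  have h := right_ne_zero_of_smul h
  have h2 := gauss_ne_zero (right_ne_zero_of_mul h)
  have h3 := gauss_ne_zero (right_ne_zero_of_mul (left_ne_zero_of_mul h))
  omega

theorem altSum_eq_zero (μ d l : ℤ) {M ε : ℤ} (h : 2 * M + ε < 0) : altSum μ d ε l M = 0 := by
  refine finsum_eq_zero_of_forall_eq_zero fun j => ?_
  rcases lt_or_ge M j with hj | hj
  · rw [gauss_eq_zero (x := l + μ * j + d) (y := M - j) (by omega)]
    simp
  · rw [gauss_eq_zero (x := l - μ * j) (y := M + j + ε) (by omega)]
    simp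

/-- The terms of index `j` and `-1 - j` cancel. -/
theorem altSum_zero_zero_one (l M : ℤ) : altSum 0 0 1 l M = 0 := by
  have h : altSum 0 0 1 l M = -altSum 0 0 1 l M := by
    conv_lhs => rw [altSum, ← finsum_comp_equiv (Equiv.subLeft (-1 : ℤ))]
    rw [altSum, ← finsum_neg_distrib]
    refine finsum_congr fun j => ?_
    rw [Equiv.subLeft_apply, altSign_sub, show altSign (-1) = -1 by simp [altSign]]
    simp only [Int.cast_zero, zero_mul, add_zero, sub_zero, qPow_zero, one_mul]
    rw [show M - (-1 - j) = M + j + 1 by ring, show M + (-1 - j) + 1 = M - j by ring,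
      mul_comm (gauss l (M + j + 1)), neg_one_mul, neg_smul]
  ext r
  have hr := congrArg (fun F : QExp => F.coeff r) h
  simp only [AddMonoidAlgebra.coeff_neg, Finsupp.neg_apply] at hr
  simp only [AddMonoidAlgebra.coeff_zero, Finsupp.zero_apply]
  omega

/-- The polynomial `∏_{i < n} (1 + s q^i Y)` in `Y`; its coefficients are given by the `q`-binomial
theorem `coeff_qProd`. -/
noncomputable def qProd (s : ℤ) (n : ℕ) : QExp[X] :=
  ∏ i ∈ Finset.range n, (1 + C (s • qPow i) * X)

theorem coeff_qProd (s : ℤ) (n k : ℕ) :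
    (qProd s n).coeff k = s ^ k • (qPow ((k : ℚ) * (k - 1) / 2) * gauss k (n - k)) := by
  induction n generalizing k with
  | zero =>
    rcases k with _ | k
    · simp [qProd, gauss_zero_left, qPow_zero]
    · rw [gauss_eq_zero (by push_cast; omega)]
      simp [qProd, coeff_one]
  | succ n ih =>
    have hP : qProd s (n + 1) = qProd s n + C (s • qPow n) * (qProd s n * X) := by
      rw [qProd, Finset.prod_range_succ, ← qProd]
      ring
    rcases k with _ | k
    · have := ih 0
      have e : (n : ℤ) + 1 - 0 = ((n + 1 : ℕ) : ℤ) := by push_cast; ring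
      rw [hP, coeff_add, this, coeff_C_mul, coeff_mul_X_zero]
      simp only [Nat.cast_zero, sub_zero]
      rw [gauss_zero_left (by omega), gauss_zero_left (by omega)]
      simp
    · rw [hP, coeff_add, coeff_C_mul, coeff_mul_X, ih, ih]
      have p := gauss_pascal' (x := k + 1) (y := n - k - 1) (by omega)
      rw [show (n : ℤ) - k - 1 + 1 = n - k by ring, show (k : ℤ) + 1 - 1 = k by ring] at p
      have e : qPow n * qPow ((k : ℚ) * (k - 1) / 2) =
          qPow (((k + 1 : ℕ) : ℚ) * ((k + 1 : ℕ) - 1) / 2) *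
            qPow (((n - k - 1 : ℤ) : ℚ) + 1) := by
        rw [← qPow_add, ← qPow_add]
        congr 1
        push_cast
        ring
      rw [show ((n + 1 : ℕ) : ℤ) - (k + 1 : ℕ) = n - k by push_cast; ring,
        show ((k + 1 : ℕ) : ℤ) = k + 1 by push_cast; ring, p,
        show (n : ℤ) - (k + 1) = n - k - 1 by ring]
      simp only [zsmul_eq_mul, Int.cast_pow]
      linear_combination (s : QExp) ^ (k + 1) * gauss k (n - k) * e

theorem qProd_mul_qProd_neg (n : ℕ) :
    qProd 1 n * qProd (-1) n = ∏ i ∈ Finset.range n, (1 - C (qPow i ^ 2) * X ^ 2) := by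
  rw [qProd, qProd, ← Finset.prod_mul_distrib]
  refine Finset.prod_congr rfl fun i _ => ?_
  rw [neg_smul, one_smul, C_neg, C_pow]
  ring

theorem neg_one_pow_mul_coeff_mem_qCone (n l : ℕ) :
    (-1) ^ l * (∏ i ∈ Finset.range n, (1 - C (qPow i ^ 2) * X ^ 2) : QExp[X]).coeff (2 * l) ∈
      qCone := by
  induction n generalizing l with
  | zero => cases l <;> simp [coeff_one, zero_mem, one_mem]
  | succ n ih =>
    set P := (∏ i ∈ Finset.range n, (1 - C (qPow i ^ 2) * X ^ 2) : QExp[X])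
    have hP : (∏ i ∈ Finset.range (n + 1), (1 - C (qPow i ^ 2) * X ^ 2) : QExp[X]) =
        P - C (qPow n ^ 2) * (P * X ^ 2) := by
      rw [Finset.prod_range_succ]
      ring
    rw [hP, coeff_sub, coeff_C_mul]
    rcases l with _ | l
    · rw [coeff_mul_X_pow', if_neg (by omega)]
      simpa using ih 0
    · rw [show 2 * (l + 1) = 2 * l + 2 by ring, coeff_mul_X_pow,
        show (-1) ^ (l + 1) * (P.coeff (2 * l + 2) - qPow n ^ 2 * P.coeff (2 * l)) =
          (-1) ^ (l + 1) * P.coeff (2 * l + 2) + qPow n ^ 2 * ((-1) ^ l * P.coeff (2 * l)) by ring]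
      exact add_mem (ih (l + 1)) (mul_mem (pow_mem (qPow_mem_qCone _) _) (ih l))

/-- The `q`-analogue of `∑_j (-1)^j [n, l + j] [n, l - j] = [n, l]`: comparing coefficients in
`∏ (1 + q^i Y) (1 - q^i Y) = ∏ (1 - q^{2i} Y²)` evaluates the sum as a Gaussian polynomial
in `q²`. Only its positivity is recorded. -/
theorem altSum_one_zero_zero_mem_qCone (l M : ℤ) : altSum 1 0 0 l M ∈ qCone := by
  by_cases hl : 0 ≤ l
  swap
  · convert zero_mem qCone
    refine finsum_eq_zero_of_forall_eq_zero fun j => ?_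
    rcases le_or_gt 0 j with hj | hj
    · rw [gauss_eq_zero (x := l - 1 * j) (by omega)]
      simp
    · rw [gauss_eq_zero (x := l + 1 * j + 0) (by omega)]
      simp
  by_cases hM : 0 ≤ M
  swap
  · rw [altSum_eq_zero _ _ _ (by omega)]
    exact zero_mem _
  lift l to ℕ using hl
  lift M to ℕ using hM
  have key : (qProd 1 (l + M) * qProd (-1) (l + M)).coeff (2 * l) =
      (-1) ^ l * (qPow ((l : ℚ) ^ 2 - l) * altSum 1 0 0 l M) := by
    rw [coeff_mul, Finset.Nat.sum_antidiagonal_eq_sum_range_succ_mk, altSum,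
      ← finsum_comp_equiv (Equiv.subRight (l : ℤ)),
      finsum_eq_sum_of_support_subset (s := (Finset.range (2 * l + 1)).map Nat.castEmbedding),
      Finset.sum_map, Finset.mul_sum, Finset.mul_sum]
    · refine Finset.sum_congr rfl fun i hi => ?_
      have hi : i ≤ 2 * l := by simpa [Nat.lt_succ_iff] using hi
      have hs : ((-1 : ℤ) ^ (2 * l - i)) = (-1) ^ l * altSign ((i : ℤ) - l) := by
        rw [← altSign_natCast, ← altSign_natCast, ← altSign_add]
        rw [Nat.cast_sub hi, altSign_sub, show (l : ℤ) + (i - l) = i by ring]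
        push_cast
        rw [two_mul, altSign_add, altSign_mul_self, one_mul]
      dsimp only
      rw [coeff_qProd, coeff_qProd, hs, Nat.cast_sub hi, Nat.cast_sub hi]
      simp only [Nat.castEmbedding_apply, Equiv.subRight_apply, one_pow, one_smul, mul_smul,
        zsmul_eq_mul]
      push_cast
      rw [show (l : ℤ) + 1 * (i - l) + 0 = i by ring, show (M : ℤ) - (i - l) = l + M - i by ring,
        show (l : ℤ) - 1 * (i - l) = 2 * l - i by ring,
        show (M : ℤ) + (i - l) + 0 = l + M - (2 * l - i) by ring]
      have e : qPow ((i : ℚ) * (i - 1) / 2) * qPow ((2 * l - i : ℚ) * (2 * l - i - 1) / 2) =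
          qPow ((l : ℚ) ^ 2 - l) * qPow (1 * (i - l : ℚ) ^ 2 + 0 * (i - l)) := by
        rw [← qPow_add, ← qPow_add]
        congr 1
        ring
      linear_combination (-1) ^ l * (altSign ((i : ℤ) - l) : QExp) * gauss i (l + M - i) *
        gauss (2 * l - i) (l + M - (2 * l - i)) * e
    · intro i hi
      have h := right_ne_zero_of_smul hi
      have h2 := gauss_ne_zero (right_ne_zero_of_mul h)
      have h3 := gauss_ne_zero (right_ne_zero_of_mul (left_ne_zero_of_mul h))
      simp only [Equiv.subRight_apply] at h2 h3
      rw [Finset.coe_map, Set.mem_image]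
      exact ⟨i.toNat, by simp; omega, by simp; omega⟩
  have h := neg_one_pow_mul_coeff_mem_qCone (l + M) l
  rw [← qProd_mul_qProd_neg, key, ← mul_assoc, ← mul_pow, neg_one_mul, neg_neg, one_pow,
    one_mul] at h
  have h' := mul_mem (qPow_mem_qCone (-((l : ℚ) ^ 2 - l))) h
  rwa [← mul_assoc, ← qPow_add, neg_add_cancel, qPow_zero, one_mul] at h'

theorem finsum_mem_qCone {F : ℤ → QExp} (h : ∀ i, F i ∈ qCone) : ∑ᶠ i, F i ∈ qCone :=
  finsum_induction (· ∈ qCone) (zero_mem _) (fun _ _ => add_mem) h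

theorem altSum_succ_mem_qCone {μ d ε : ℤ} (hε : ε = 0 ∨ ε = 1) (hd : 0 ≤ d) (hμ : d ≤ 2 * μ)
    (h : ∀ l M, altSum μ d ε l M ∈ qCone) (l M : ℤ) :
    altSum (μ + 1) (d + ε) ε l M ∈ qCone := by
  rw [altSum_burge l M hε hd hμ]
  exact finsum_mem_qCone fun I =>
    mul_mem (mul_mem (qPow_mem_qCone _) (gauss_mem_qCone _ _)) (h _ _)

theorem altSum_zero_mem_qCone (μ : ℕ) (l M : ℤ) : altSum (μ + 1) 0 0 l M ∈ qCone := by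
  induction μ generalizing l M with
  | zero => simpa using altSum_one_zero_zero_mem_qCone l M
  | succ μ ih =>
    have := altSum_succ_mem_qCone (.inl rfl) le_rfl (by omega) ih l M
    push_cast
    simpa using this

/-- Passing from `b_j = j` to `b_j = j + 1/2`: the `q`-Pascal rule in the second factor. -/
theorem altSum_pascal {μ : ℤ} (hμ : 0 < μ) (l M : ℤ) :
    altSum μ 0 1 l M = altSum μ 0 0 l M + qPow (M + 1) * altSum μ 1 1 (l - 1) M := by
  simp only [altSum]
  rw [mul_finsum, ← finsum_add_distrib (altSum_hasFiniteSupport _ _ _ _ _)]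
  · refine finsum_congr fun j => ?_
    rw [mul_smul_comm, ← smul_add]
    congr 1
    by_cases h : 0 ≤ l - μ * j + (M + j)
    · rw [gauss_pascal' h, show l - 1 + μ * j + 1 = l + μ * j by ring,
        show l - 1 - μ * j = l - μ * j - 1 by ring]
      have e : qPow (μ * j ^ 2 + (0 : ℤ) * j) * qPow ((M + j : ℤ) + 1) =
          qPow (M + 1) * qPow (μ * j ^ 2 + (1 : ℤ) * j) := by
        rw [← qPow_add, ← qPow_add]
        congr 1
        push_cast
        ring
      simp only [add_zero]
      linear_combination gauss (l + μ * j) (M - j) * gauss (l - μ * j - 1) (M + j + 1) * e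
    · rw [gauss_eq_zero (x := l - μ * j) (y := M + j + 0) (by omega),
        gauss_eq_zero (x := l - 1 - μ * j) (y := M + j + 1) (by omega)]
      simp only [mul_zero, add_zero]
      -- The corner excluded by the Pascal rule: there the first factor vanishes.
      by_contra h0
      have h2 := gauss_ne_zero (right_ne_zero_of_mul h0)
      have h3 := gauss_ne_zero (right_ne_zero_of_mul (left_ne_zero_of_mul h0))
      have : 0 < μ * (-j) := mul_pos hμ (by omega)
      have : μ * (-j) = -(μ * j) := by ring
      omega
  · refine support_finite_of_bound (-M - 1) M fun j h => ?_
    have h := right_ne_zero_of_smul (right_ne_zero_of_mul h)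
    have h2 := gauss_ne_zero (right_ne_zero_of_mul h)
    have h3 := gauss_ne_zero (right_ne_zero_of_mul (left_ne_zero_of_mul h))
    omega

theorem altSum_zero_one_mem_qCone (μ : ℕ) (l M : ℤ) : altSum μ 0 1 l M ∈ qCone := by
  induction μ generalizing l M with
  | zero =>
    rw [Nat.cast_zero, altSum_zero_zero_one]
    exact zero_mem _
  | succ μ ih =>
    rw [altSum_pascal (by omega)]
    have h := altSum_succ_mem_qCone (.inr rfl) le_rfl (by omega) ih (l - 1) M
    push_cast
    exact add_mem (altSum_zero_mem_qCone μ l M) (mul_mem (qPow_mem_qCone _) h)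

theorem altSum_one_mem_qCone (m d : ℕ) (l M : ℤ) : altSum (m + d) d 1 l M ∈ qCone := by
  induction d generalizing l M with
  | zero => simpa using altSum_zero_one_mem_qCone m l M
  | succ d ih =>
    have := altSum_succ_mem_qCone (.inr rfl) (by omega) (by omega) ih l M
    push_cast
    rwa [← add_assoc]

/-- Positivity at the root of the hierarchy. If `Δ = 0` the last Burge step has `b_j = j`, and
otherwise `b_j = j + 1/2`; for `v = 1` no step would be left after the initial sum. -/
theorem finsum_root_mem_qCone {v Δ : ℕ} (hv : 2 ≤ v) (hΔ : Δ < v) (l : ℤ) :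
    ∑ᶠ j : ℤ, altSign j • (qPow (v * j ^ 2 + Δ * j) * gauss (l - v * j) (l + v * j + Δ)) ∈
      qCone := by
  rcases Δ with _ | d
  · obtain ⟨μ, rfl⟩ : ∃ μ, v = μ + 1 + 1 := ⟨v - 2, by omega⟩
    have h := finsum_burge_limit l (μ := μ + 1) (d := 0) (.inl rfl) le_rfl (by omega)
    push_cast at h ⊢
    simp only [add_zero] at h ⊢
    rw [h]
    exact finsum_mem_qCone fun I => mul_mem (qPow_mem_qCone _) (altSum_zero_mem_qCone μ _ _)
  · obtain ⟨m, rfl⟩ : ∃ m, v = m + d + 1 := ⟨v - d - 1, by omega⟩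
    have h := finsum_burge_limit l (μ := m + d) (d := d) (.inr rfl) (by omega) (by omega)
    push_cast at h ⊢
    rw [h]
    exact finsum_mem_qCone fun I => mul_mem (qPow_mem_qCone _) (altSum_one_mem_qCone m d _ _)

/-! ### The doubling transform -/

/-- The coefficient of `x^a` in a `q`-analogue of `(x + x⁻¹)^k`: the Gaussian polynomial
`[k, (k - a) / 2]` if `k ≡ a` modulo `2`, and `0` otherwise. -/
noncomputable def walkGauss (k a : ℤ) : QExp :=
  if 2 ∣ k - a then gauss ((k - a) / 2) ((k + a) / 2) else 0

theorem walkGauss_two_mul_add (r a : ℤ) : walkGauss (2 * r + a) a = gauss r (r + a) := by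
  rw [walkGauss, if_pos (by omega)]
  congr 1 <;> omega

theorem walkGauss_two_mul (L a : ℤ) : walkGauss (2 * L) (2 * a) = gauss (L - a) (L + a) := by
  rw [show 2 * L = 2 * (L - a) + 2 * a by ring, walkGauss_two_mul_add]
  congr 1
  ring

/-- The coefficients of the doubling transform, `q`-analogues of the coefficients
`L.choose k * 2 ^ (L - k)` in the expansion of `(x + 2 + x⁻¹)^L` in powers of `x + x⁻¹`. The index
`m` is summed over a `q`-analogue of `2 ^ (L - k)`. -/
noncomputable def doublingCoeff (L k : ℤ) : QExp :=
  ∑ᶠ m : ℤ, qPow ((k : ℚ) ^ 2 / 2 + m ^ 2 + m * k) * gauss k (L - k) * gauss m (L - k - m)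

theorem finsum_of_dvd {f : ℤ → QExp} {a : ℤ} (hf : ∀ k, ¬ 2 ∣ k - a → f k = 0) :
    ∑ᶠ k, f k = ∑ᶠ r : ℤ, f (2 * r + a) := by
  rw [← finsum_mem_range (f := f) (g := fun r : ℤ => 2 * r + a) (fun x y h => by grind)]
  refine finsum_congr fun k => ?_
  by_cases h : 2 ∣ k - a
  · rw [finsum_eq_single _ ⟨(k - a) / 2, by grind⟩]
    intro n hn
    exact absurd rfl hn
  · rw [hf k h]
    simp

/-- The doubling transform. Two applications of `gauss_vandermonde` expand the right-hand side
into `q`-multinomial coefficients, which regroup into the left-hand side. -/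
theorem finsum_doubling {L : ℤ} (hL : 0 ≤ L) (a : ℤ) :
    ∑ᶠ k : ℤ, doublingCoeff L k * walkGauss k a =
      qPow ((a : ℚ) ^ 2 / 2) * gauss (L - a) (L + a) := by
  have expand (u : ℤ) : qPow (u * (u + a)) * gauss u (L - u) * gauss (u + a) (L - u - a) =
      ∑ᶠ r : ℤ, qPow (u * (u + a)) * gauss u (L - u) * (qPow (r * (r + a)) * gauss r (u - r) *
        gauss (r + a) (L - u - r - a)) := by
    by_cases h : 0 ≤ u ∧ 0 ≤ L - u
    · rw [← mul_finsum, gauss_vandermonde h.1 h.2]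
    · rw [gauss_eq_zero (x := u) (y := L - u) (by omega)]
      simp
  rw [gauss_comm, ← gauss_vandermonde hL hL a, finsum_congr expand, finsum_swap 0 L 0 L,
    finsum_of_dvd (a := a), mul_finsum]
  · refine finsum_congr fun r => ?_
    rw [doublingCoeff, walkGauss_two_mul_add, finsum_mul, mul_finsum,
      eq_comm, ← finsum_comp_equiv (Equiv.addRight r), eq_comm]
    refine finsum_congr fun m => ?_
    rw [Equiv.coe_addRight]
    have m1 := gauss_mul_gauss (m + r) (r + a) (L - (2 * r + a) - m)
    have m2 := gauss_mul_gauss m r (r + a)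
    have m3 := gauss_mul_gauss (2 * r + a) m (L - (2 * r + a) - m)
    rw [show r + a + (L - (2 * r + a) - m) = L - (m + r) by ring,
      show m + r + (r + a) = 2 * r + a + m by ring] at m1
    rw [show r + (r + a) = 2 * r + a by ring, gauss_comm m r, gauss_comm m (2 * r + a)] at m2
    rw [show m + (L - (2 * r + a) - m) = L - (2 * r + a) by ring] at m3
    rw [show m + r - r = m by ring, show L - (m + r) - r - a = L - (2 * r + a) - m by ring]
    have e : qPow (((2 * r + a : ℤ) : ℚ) ^ 2 / 2 + m ^ 2 + m * (2 * r + a : ℤ)) =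
        qPow ((a : ℚ) ^ 2 / 2) * (qPow ((m + r : ℤ) * ((m + r : ℤ) + a)) *
          qPow (r * (r + a))) := by
      rw [← qPow_add, ← qPow_add]
      congr 1
      push_cast
      ring
    rw [e]
    set Q := qPow ((a : ℚ) ^ 2 / 2)
    set Q1 := qPow ((m + r : ℤ) * ((m + r : ℤ) + (a : ℚ)))
    set Q2 := qPow ((r : ℚ) * (r + a))
    linear_combination Q * Q1 * Q2 * (gauss r (r + a) * m3 - gauss r m * m1 +
      gauss (2 * r + a + m) (L - (2 * r + a) - m) * m2)
  · intro k hk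
    rw [walkGauss, if_neg hk, mul_zero]
  · intro u r h
    have h1 := gauss_ne_zero (right_ne_zero_of_mul (left_ne_zero_of_mul h))
    have h2 := gauss_ne_zero (right_ne_zero_of_mul (left_ne_zero_of_mul (right_ne_zero_of_mul h)))
    omega

theorem doublingCoeff_mem_qCone (L k : ℤ) : doublingCoeff L k ∈ qCone :=
  finsum_mem_qCone fun _ =>
    mul_mem (mul_mem (qPow_mem_qCone _) (gauss_mem_qCone _ _)) (gauss_mem_qCone _ _)

theorem doublingCoeff_eq_zero {L k : ℤ} (h : k < 0 ∨ L < k) : doublingCoeff L k = 0 :=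
  finsum_eq_zero_of_forall_eq_zero fun m => by
    rw [gauss_eq_zero (x := k) (y := L - k) (by omega)]
    simp

/-! ### The hierarchy obtained by iterated doubling -/

/-- The integer `(4^n - 1) / 3`. -/
def fourSum (n : ℕ) : ℤ := ∑ i ∈ Finset.range n, 4 ^ i

theorem fourSum_succ (n : ℕ) : fourSum (n + 1) = fourSum n + 4 ^ n := by
  rw [fourSum, Finset.sum_range_succ, ← fourSum]

theorem fourSum_nonneg (n : ℕ) : 0 ≤ fourSum n :=
  Finset.sum_nonneg fun i _ => by positivity

theorem three_mul_fourSum (n : ℕ) : 3 * fourSum n = 4 ^ n - 1 := by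
  induction n with
  | zero => simp [fourSum]
  | succ n ih => rw [fourSum_succ, mul_add, ih]; ring

/-- The exponent `e_n(j) = (2 v (4^n - 1) / 3 + 1) j (v j + Δ)` of `q` in the term of index `j` at
level `n` of the hierarchy. -/
def levelExponent (v Δ n : ℕ) (j : ℤ) : ℤ := (2 * fourSum n * v + 1) * (j * (v * j + Δ))

theorem levelExponent_nonneg {v Δ : ℕ} (hΔ : Δ < v) (n : ℕ) (j : ℤ) :
    0 ≤ levelExponent v Δ n j := by
  have h1 := fourSum_nonneg n
  refine mul_nonneg (by positivity) ?_
  rcases lt_or_ge j 0 with hj | hj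
  · exact mul_nonneg_of_nonpos_of_nonpos hj.le (by nlinarith)
  · positivity

/-- The shift `a = 2^n (Δ + 2 v j)`: the Gaussian polynomial of index `j` has lower entry
`(k - a) / 2` at level `n`, and `L - a` at level `n + 1` with `k = 2 L`. -/
def levelShift (v Δ n : ℕ) (j : ℤ) : ℤ := 2 ^ n * (Δ + 2 * v * j)

theorem abs_le_abs_levelShift {v Δ : ℕ} (hΔ : Δ < v) (n : ℕ) (j : ℤ) :
    |j| ≤ |levelShift v Δ n j| := by
  have h2 : (1 : ℤ) ≤ 2 ^ n := one_le_pow₀ (by norm_num)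
  rw [levelShift, abs_mul, abs_of_pos (by omega : (0 : ℤ) < 2 ^ n)]
  have h : |j| ≤ |(Δ : ℤ) + 2 * v * j| := by
    rcases lt_or_ge j 0 with hj | hj
    · rw [abs_of_neg hj, abs_of_neg (by nlinarith)]
      nlinarith
    · rw [abs_of_nonneg hj, abs_of_nonneg (by positivity)]
      nlinarith
  nlinarith [abs_nonneg ((Δ : ℤ) + 2 * v * j)]

/-- The sum at level `n` with top entry `k`, namely
`∑_j (-1)^j q^{e_n(j)} [k, (k - 2^n (Δ + 2 v j)) / 2]`. -/
noncomputable def levelSum (v Δ n : ℕ) (k : ℤ) : QExp :=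
  ∑ᶠ j : ℤ, altSign j • (qPow (levelExponent v Δ n j) * walkGauss k (levelShift v Δ n j))

theorem levelSum_zero_mem_qCone {v Δ : ℕ} (hv : 2 ≤ v) (hΔ : Δ < v) (k : ℤ) :
    levelSum v Δ 0 k ∈ qCone := by
  by_cases h : 2 ∣ k - Δ
  · obtain ⟨l, hl⟩ := h
    convert finsum_root_mem_qCone hv hΔ l using 1
    refine finsum_congr fun j => ?_
    congr 2
    · congr 1
      simp only [levelExponent, fourSum, Finset.range_zero, Finset.sum_empty]
      push_cast
      ring
    · rw [show k = 2 * (l - v * j) + levelShift v Δ 0 j by rw [levelShift]; grind,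
        walkGauss_two_mul_add, levelShift]
      congr 1
      ring
  · convert zero_mem qCone
    refine finsum_eq_zero_of_forall_eq_zero fun j => ?_
    rw [walkGauss, if_neg, mul_zero, smul_zero]
    rw [levelShift, pow_zero, one_mul, mul_assoc]
    omega

/-- One level up, the sum is a combination with coefficients in `qCone` of sums at the previous
level, up to a power of `q` normalizing the term `j = 0`. -/
theorem finsum_level_succ {v Δ : ℕ} (hΔ : Δ < v) (n : ℕ) {L : ℤ} (hL : 0 ≤ L) :
    ∑ᶠ j : ℤ, altSign j • (qPow (levelExponent v Δ (n + 1) j) *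
        gauss (L - levelShift v Δ n j) (L + levelShift v Δ n j)) =
      qPow (-((levelShift v Δ n 0 : ℚ) ^ 2 / 2)) *
        ∑ᶠ k : ℤ, doublingCoeff L k * levelSum v Δ n k := by
  have expand (k : ℤ) : doublingCoeff L k * levelSum v Δ n k = ∑ᶠ j : ℤ, altSign j •
      (qPow (levelExponent v Δ n j) * (doublingCoeff L k * walkGauss k (levelShift v Δ n j))) := by
    rw [levelSum, mul_finsum]
    refine finsum_congr fun j => ?_
    rw [mul_smul_comm, mul_left_comm]
  rw [finsum_congr expand, finsum_swap 0 L (-L) L, mul_finsum]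
  · refine finsum_congr fun j => ?_
    rw [← smul_finsum, ← mul_finsum, finsum_doubling hL, mul_smul_comm, ← mul_assoc, ← mul_assoc,
      ← qPow_add, ← qPow_add]
    congr 3
    rw [levelExponent, levelExponent, levelShift, levelShift, fourSum_succ,
      show (4 : ℤ) ^ n = (2 ^ n) ^ 2 by rw [← pow_mul, mul_comm, pow_mul]; norm_num]
    push_cast
    ring
  · intro k j h
    have h := right_ne_zero_of_mul (right_ne_zero_of_smul h)
    have h1 : 0 ≤ k ∧ k ≤ L := by
      by_contra h'
      exact left_ne_zero_of_mul h (doublingCoeff_eq_zero (by omega))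
    have h2 : |levelShift v Δ n j| ≤ k := by
      have h3 := right_ne_zero_of_mul h
      rw [walkGauss] at h3
      split_ifs at h3 with hd
      · have := gauss_ne_zero h3
        rw [abs_le]
        omega
      · exact absurd rfl h3
    have h4 := (abs_le_abs_levelShift hΔ n j).trans h2
    rw [abs_le] at h4
    omega

theorem finsum_level_mem_qCone {v Δ : ℕ} (hΔ : Δ < v) (n : ℕ)
    (h : ∀ k, levelSum v Δ n k ∈ qCone) (L : ℤ) :
    ∑ᶠ j : ℤ, altSign j • (qPow (levelExponent v Δ (n + 1) j) *
      gauss (L - levelShift v Δ n j) (L + levelShift v Δ n j)) ∈ qCone := by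
  by_cases hL : 0 ≤ L
  · rw [finsum_level_succ hΔ n hL]
    exact mul_mem (qPow_mem_qCone _)
      (finsum_mem_qCone fun k => mul_mem (doublingCoeff_mem_qCone L k) (h k))
  · convert zero_mem qCone
    refine finsum_eq_zero_of_forall_eq_zero fun j => ?_
    rw [gauss_eq_zero (by omega), mul_zero, smul_zero]

theorem levelSum_mem_qCone {v Δ : ℕ} (hv : 2 ≤ v) (hΔ : Δ < v) (n : ℕ) (k : ℤ) :
    levelSum v Δ n k ∈ qCone := by
  induction n generalizing k with
  | zero => exact levelSum_zero_mem_qCone hv hΔ k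
  | succ n ih =>
    have hs (j : ℤ) : levelShift v Δ (n + 1) j = 2 * levelShift v Δ n j := by
      rw [levelShift, levelShift, pow_succ]
      ring
    by_cases hk : 2 ∣ k
    · obtain ⟨L, rfl⟩ := hk
      convert finsum_level_mem_qCone hΔ n ih L using 1
      refine finsum_congr fun j => ?_
      rw [hs, walkGauss_two_mul]
    · convert zero_mem qCone
      refine finsum_eq_zero_of_forall_eq_zero fun j => ?_
      rw [walkGauss, if_neg (by rw [hs]; omega), mul_zero, smul_zero]

/-! ### Clearing the fractions in the exponents -/

theorem gauss_mem_range (x y : ℤ) : gauss x y ∈ polyToQExp.range := ⟨_, rfl⟩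

theorem qPow_mem_range {r : ℤ} (hr : 0 ≤ r) : qPow r ∈ polyToQExp.range := by
  lift r to ℕ using hr
  exact ⟨X ^ r, by simpa using polyToQExp_X_pow r⟩

theorem bressoudTerm_eq {v : ℕ} (hv : 0 < v) (Δ n L : ℕ) (j : ℤ) :
    bressoudTerm ((L : ℤ) - (Δ : ℤ) * 2 ^ n) ((L : ℤ) + (Δ : ℤ) * 2 ^ n)
        (((v : ℚ) + Δ) * (2 * ((2 ^ (n + 1) - (2 ^ (n + 1))⁻¹) / 3) + 1 / (2 ^ (n + 1) * v)))
        (((v : ℚ) - Δ) * (2 * ((2 ^ (n + 1) - (2 ^ (n + 1))⁻¹) / 3) + 1 / (2 ^ (n + 1) * v)))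
        (2 ^ (n + 1) * (v : ℤ)) j =
      altSign j • (qPow (levelExponent v Δ (n + 1) j) *
        gauss (L - levelShift v Δ n j) (L + levelShift v Δ n j)) := by
  have hv' : (v : ℚ) ≠ 0 := by positivity
  have h4 : (fourSum (n + 1) : ℚ) = ((2 ^ (n + 1)) ^ 2 - 1) / 3 := by
    have h : (3 : ℚ) * fourSum (n + 1) = 4 ^ (n + 1) - 1 := by
      exact_mod_cast three_mul_fourSum (n + 1)
    rw [← pow_mul, mul_comm, pow_mul]
    norm_num
    linarith
  have hx : (2 : ℚ) ^ (n + 1) ≠ 0 := by positivity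
  rw [bressoudTerm, altSign, gauss]
  congr 2
  · rw [levelExponent]
    push_cast
    rw [h4]
    generalize (2 : ℚ) ^ (n + 1) = x at hx
    congr 1
    field_simp
    ring
  · rw [levelShift]
    congr 2 <;> ring

theorem theoremT4p6 (v n Δ L : ℕ) (hv : 2 ≤ v) (hn : 1 ≤ n) (hΔ : Δ < v) :
    IsNonnegPoly
      (bressoudG ((L : ℤ) - (Δ : ℤ) * 2 ^ (n - 1)) ((L : ℤ) + (Δ : ℤ) * 2 ^ (n - 1))
        (((v : ℚ) + Δ) * (2 * ((2 ^ n - (2 ^ n)⁻¹) / 3) + 1 / (2 ^ n * v)))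
        (((v : ℚ) - Δ) * (2 * ((2 ^ n - (2 ^ n)⁻¹) / 3) + 1 / (2 ^ n * v)))
        (2 ^ n * (v : ℤ))) := by
  obtain ⟨n, rfl⟩ : ∃ m, n = m + 1 := ⟨n - 1, by omega⟩
  rw [Nat.add_sub_cancel, bressoudG, finsum_congr (bressoudTerm_eq (by omega) Δ n L)]
  refine isNonnegPoly_of_mem
    (finsum_level_mem_qCone hΔ n (levelSum_mem_qCone hv hΔ n) L)
    (finsum_induction (· ∈ polyToQExp.range) (zero_mem _) (fun _ _ => add_mem) fun j => ?_)
  exact zsmul_mem (mul_mem (qPow_mem_range (levelExponent_nonneg hΔ _ j))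
    (gauss_mem_range _ _)) _
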